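/- Let $x_1,\dots,x_n\in\mathbb{R}$ be not all equal, $\bar x=\frac1n\sum_{i=1}^n x_i$, let $\sigma>0$ be known and let $\boldsymbol{\beta_0}=(\beta_{1},\beta_{2})^{\intercal}\in\mathbb{R}^2$. Let $Y_1,\dots,Y_n$ be independent random variables with $Y_i\sim{\rm N}(\beta_1+\beta_2(x_i-\bar x),\sigma^2)$. Let $f_i(\cdot\,|\boldsymbol\beta)$ denote the density of the $i$-th response under the parameter $\boldsymbol\beta\in\mathbb{R}^2$, and let $$\bar I_n(\boldsymbol\beta)=\frac1n\sum_{i=1}^n\left(-{\rm E}_{\boldsymbol\beta}\left[\frac{\partial^2}{\partial\beta_k\partial\beta_l}\log f_i(Y_i|\boldsymbol\beta)\right]\right)_{k,l=1,2}$$ be the average Fisher information matrix, where ${\rm E}_{\boldsymbol\beta}$ is expectation when the true parameter is $\boldsymbol\beta$. The maximum likelihood estimator of $\boldsymbol{\beta_0}$, i.e. the maximiser $\boldsymbol{\hat\beta}$ over $\boldsymbol\beta\in\mathbb{R}^2$ of $\prod_{i=1}^n f_i(Y_i|\boldsymbol\beta)$, exists, is unique, and equals $$\boldsymbol{\hat\beta}=\left(\bar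 Y,\ \frac{\sum_{i=1}^n(x_i-\bar x)Y_i}{\sum_{i=1}^n(x_i-\bar x)^2}\right)^{\intercal},\qquad \bar Y=\frac1n\sum_{i=1}^nY_i .$$ Let $\boldsymbol Z\sim{\rm N}_2(\boldsymbol 0,I_{2\times2})$ and let $h:\mathbb{R}^2\to\mathbb{R}$ be three times differentiable with bounded derivatives of orders one, two and three. Write $\|h\|_2=\sup_{i,j}\sup_{x}\left|\frac{\partial^2 h}{\partial x_i\partial x_j}(x)\right|$ and $\|h\|_3=\sup_{i,j,k}\sup_x\left|\frac{\partial^3 h}{\partial x_i\partial x_j\partial x_k}(x)\right|$. Then the expectations below exist and are finite, and, with $[\cdot]^{1/2}$ denoting the positive semidefinite square root, $$\left|{\rm E}\left[h\left(\sqrt n\,[\bar I_n(\boldsymbol{\beta_0})]^{1/2}(\boldsymbol{\hat\beta}-\boldsymbol{\beta_0})\right)\right]-{\rm E}[h(\boldsymbol Z)]\right|\le\frac{\|h\|_2}{4}\left(\sqrt{\frac2n}+\frac{\sqrt{2\sum_{i=1}^n(x_i-\bar x)^4}}{\sum_{i=1}^n(x_i-\bar x)^2}\right)+\frac{\|h\|_2}{\sqrt{2n}}+\frac{8\|h\|_3}{3\sqrt\pi}\left(\frac1{\sqrt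 n}+\frac{\sum_{i=1}^n|x_i-\bar x|^3}{\left[\sum_{i=1}^n(x_i-\bar x)^2\right]^{3/2}}\right).$$ -/

import Mathlib

open MeasureTheory ProbabilityTheory
open scoped BigOperators NNReal MatrixOrder

noncomputable section

namespace SimpleLinear

/-! ### Test functions -/

/-- The partial derivative `∂f/∂x_i`. -/
def partialDeriv {d : ℕ} (i : Fin d) (f : EuclideanSpace ℝ (Fin d) → ℝ) :
    EuclideanSpace ℝ (Fin d) → ℝ :=
  fun x => lineDeriv ℝ f x (EuclideanSpace.single i (1 : ℝ))

/-- The class `H`: the function is three times (Fréchet) differentiable, and its derivatives of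
orders one, two and three are bounded. The function itself need not be bounded. (In finite
dimension, the derivative of `f` is differentiable iff all partial derivatives of `f` are.) -/
structure IsTestFunction {d : ℕ} (h : EuclideanSpace ℝ (Fin d) → ℝ) : Prop where
  differentiable₁ : Differentiable ℝ h
  differentiable₂ : ∀ i, Differentiable ℝ (partialDeriv i h)
  differentiable₃ : ∀ i j, Differentiable ℝ (partialDeriv i (partialDeriv j h))
  bounded₁ : ∃ C : ℝ, ∀ i x, |partialDeriv i h x| ≤ C
  bounded₂ : ∃ C : ℝ, ∀ i j x, |partialDeriv i (partialDeriv j h) x| ≤ C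
  bounded₃ : ∃ C : ℝ, ∀ i j k x, |partialDeriv i (partialDeriv j (partialDeriv k h)) x| ≤ C

/-- `‖h‖₂ = sup_{i,j} sup_x |∂²h/∂x_i∂x_j (x)|`. -/
def derivNorm₂ {d : ℕ} (h : EuclideanSpace ℝ (Fin d) → ℝ) : ℝ :=
  ⨆ i : Fin d, ⨆ j : Fin d, ⨆ x, |partialDeriv i (partialDeriv j h) x|

/-- `‖h‖₃ = sup_{i,j,k} sup_x |∂³h/∂x_i∂x_j∂x_k (x)|`. -/
def derivNorm₃ {d : ℕ} (h : EuclideanSpace ℝ (Fin d) → ℝ) : ℝ :=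
  ⨆ i : Fin d, ⨆ j : Fin d, ⨆ k : Fin d,
    ⨆ x, |partialDeriv i (partialDeriv j (partialDeriv k h)) x|

/-! ### The straight-line regression model -/

/-- The mean `x̄` of the covariates. -/
def mean {n : ℕ} (x : Fin n → ℝ) : ℝ := (∑ i, x i) / n

/-- The regression function `β₁ + β₂ (x_i - x̄)`; the parameters `β₁`, `β₂` are the coordinates
`β 0`, `β 1`. -/
def line {n : ℕ} (x : Fin n → ℝ) (β : EuclideanSpace ℝ (Fin 2)) (i : Fin n) : ℝ :=
  β 0 + β 1 * (x i - mean x)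

/-- The law `N(β₁ + β₂ (x_i - x̄), σ²)` of the `i`-th response. -/
def responseLaw {n : ℕ} (x : Fin n → ℝ) (σ : ℝ) (β : EuclideanSpace ℝ (Fin 2)) (i : Fin n) :
    Measure ℝ :=
  gaussianReal (line x β i) (σ ^ 2).toNNReal

/-- The probability density function `f_i(y | β)` of the `i`-th response. -/
def density {n : ℕ} (x : Fin n → ℝ) (σ : ℝ) (i : Fin n) (β : EuclideanSpace ℝ (Fin 2))
    (y : ℝ) : ℝ :=
  gaussianPDFReal (line x β i) (σ ^ 2).toNNReal y

/-- The likelihood function `L(β; y) = ∏ f_i(y_i | β)`. -/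
def likelihood {n : ℕ} (x : Fin n → ℝ) (σ : ℝ) (β : EuclideanSpace ℝ (Fin 2))
    (y : Fin n → ℝ) : ℝ :=
  ∏ i, density x σ i β (y i)

/-- `b` is a maximum likelihood estimate of `β` for the observations `y`. -/
def IsMLE {n : ℕ} (x : Fin n → ℝ) (σ : ℝ) (y : Fin n → ℝ) (b : EuclideanSpace ℝ (Fin 2)) :
    Prop :=
  ∀ β, likelihood x σ β y ≤ likelihood x σ b y

/-- The Hessian matrix `J_i(y, β)` of `β ↦ log f_i(y | β)`. -/
def logDensityHessian {n : ℕ} (x : Fin n → ℝ) (σ : ℝ) (i : Fin n) (y : ℝ)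
    (β : EuclideanSpace ℝ (Fin 2)) : Matrix (Fin 2) (Fin 2) ℝ :=
  Matrix.of fun k l => partialDeriv k (partialDeriv l fun b => Real.log (density x σ i b y)) β

/-- The Fisher information matrix `I_i(β) = -E[J_i(Y_i, β)]` of the `i`-th response. -/
def fisherInfo {n : ℕ} (x : Fin n → ℝ) (σ : ℝ) (i : Fin n) (β : EuclideanSpace ℝ (Fin 2)) :
    Matrix (Fin 2) (Fin 2) ℝ :=
  Matrix.of fun k l => -∫ y, logDensityHessian x σ i y β k l ∂(responseLaw x σ β i)

/-- The average Fisher information matrix `Ī_n(β) = (1/n) ∑ I_i(β)`. -/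
def avgFisherInfo {n : ℕ} (x : Fin n → ℝ) (σ : ℝ) (β : EuclideanSpace ℝ (Fin 2)) :
    Matrix (Fin 2) (Fin 2) ℝ :=
  (n : ℝ)⁻¹ • ∑ i, fisherInfo x σ i β

/-- The normalized estimator `√n [Ī_n(β₀)]^{1/2} (b - β₀)`, where the square root is the positive
semidefinite square root of a matrix. -/
def normalized {n : ℕ} (x : Fin n → ℝ) (σ : ℝ) (β₀ b : EuclideanSpace ℝ (Fin 2)) :
    EuclideanSpace ℝ (Fin 2) :=
  √(n : ℝ) • Matrix.toEuclideanLin (CFC.sqrt (avgFisherInfo x σ β₀)) (b - β₀)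

end SimpleLinear

end

open SimpleLinear

/-!
In a Gaussian linear model with design matrix `A` and known variance `σ²`, maximising the
likelihood means minimising the residual sum of squares, and Pythagoras shows that the unique
minimiser is the solution `b` of the normal equations `(Aᵀ * A) *ᵥ b = Aᵀ *ᵥ y`. Hence the
estimator is a linear image of the Gaussian responses, with law `N(β₀, σ² (Aᵀ * A)⁻¹)`. The total
Fisher information is `S = σ⁻² (Aᵀ * A)`, the inverse of this covariance, so `S^{1/2} (b - β₀)`
is *exactly* standard normal for every sample size. The two expectations therefore coincide, and
the bound only has to be nonnegative.
-/

namespace SimpleLinear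

open Matrix WithLp

section TestFunctions

variable {d : ℕ} {h : EuclideanSpace ℝ (Fin d) → ℝ}

lemma partialDeriv_eq_fderiv {z : EuclideanSpace ℝ (Fin d)} (hh : DifferentiableAt ℝ h z)
    (i : Fin d) : partialDeriv i h z = fderiv ℝ h z (EuclideanSpace.single i 1) :=
  hh.lineDeriv_eq_fderiv

lemma norm_fderiv_le_of_abs_partialDeriv_le {z : EuclideanSpace ℝ (Fin d)}
    (hh : DifferentiableAt ℝ h z) {C : ℝ} (hC : ∀ i, |partialDeriv i h z| ≤ C) :
    ‖fderiv ℝ h z‖ ≤ d * |C| := by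
  refine ContinuousLinearMap.opNorm_le_bound _ (by positivity) fun v => ?_
  have hv : v = ∑ i, v i • EuclideanSpace.single i (1 : ℝ) := by
    ext j
    simp [Finset.sum_apply, Pi.single_apply]
  calc ‖fderiv ℝ h z v‖ = ‖∑ i, v i * partialDeriv i h z‖ := by
        conv_lhs => rw [hv]
        simp [partialDeriv_eq_fderiv hh]
    _ ≤ ∑ i, ‖v i * partialDeriv i h z‖ := norm_sum_le _ _
    _ ≤ ∑ _i : Fin d, ‖v‖ * |C| := by
        refine Finset.sum_le_sum fun i _ => ?_
        rw [norm_mul]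
        gcongr
        · exact PiLp.norm_apply_le v i
        · exact (hC i).trans (le_abs_self C)
    _ = d * |C| * ‖v‖ := by simp; ring

lemma IsTestFunction.exists_lipschitzWith (hh : IsTestFunction h) : ∃ K, LipschitzWith K h := by
  obtain ⟨C, hC⟩ := hh.bounded₁
  exact ⟨d * ‖C‖₊, lipschitzWith_of_nnnorm_fderiv_le hh.differentiable₁ fun z =>
    norm_fderiv_le_of_abs_partialDeriv_le (hh.differentiable₁ z) fun i => hC i z⟩

lemma derivNorm₂_nonneg (h : EuclideanSpace ℝ (Fin d) → ℝ) : 0 ≤ derivNorm₂ h :=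
  Real.iSup_nonneg fun _ => Real.iSup_nonneg fun _ => Real.iSup_nonneg fun _ => abs_nonneg _

lemma derivNorm₃_nonneg (h : EuclideanSpace ℝ (Fin d) → ℝ) : 0 ≤ derivNorm₃ h :=
  Real.iSup_nonneg fun _ => Real.iSup_nonneg fun _ => Real.iSup_nonneg fun _ =>
    Real.iSup_nonneg fun _ => abs_nonneg _

end TestFunctions

lemma integrable_comp_of_lipschitzWith {Ω E F : Type*} [MeasurableSpace Ω] {P : Measure Ω}
    [IsFiniteMeasure P] [NormedAddCommGroup E] [NormedAddCommGroup F] {f : E → F} {K : ℝ≥0}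
    (hf : LipschitzWith K f) {X : Ω → E} (hX : Integrable X P) :
    Integrable (fun ω => f (X ω)) P := by
  have hcentred : Integrable (fun ω => f (X ω) - f 0) P := by
    refine (hX.norm.const_mul K).mono'
      ((hf.continuous.comp_aestronglyMeasurable hX.1).sub aestronglyMeasurable_const)
      (ae_of_all _ fun ω => ?_)
    simpa using hf.norm_sub_le (X ω) 0
  exact (hcentred.add (integrable_const (f 0))).congr (ae_of_all _ fun ω => sub_add_cancel _ _)

section LeastSquares

variable {R ι κ : Type*} [CommRing R] [Fintype ι] [Fintype κ] {A : Matrix ι κ R} {y : ι → R}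
  {b : κ → R}

lemma dotProduct_residual_eq_add (hb : (Aᵀ * A) *ᵥ b = Aᵀ *ᵥ y) (c : κ → R) :
    (y - A *ᵥ c) ⬝ᵥ (y - A *ᵥ c) =
      (y - A *ᵥ b) ⬝ᵥ (y - A *ᵥ b) + (A *ᵥ (c - b)) ⬝ᵥ (A *ᵥ (c - b)) := by
  have hres : Aᵀ *ᵥ (y - A *ᵥ b) = 0 := by
    rw [mulVec_sub, mulVec_mulVec, hb, sub_self]
  have horth : (y - A *ᵥ b) ⬝ᵥ (A *ᵥ (c - b)) = 0 := by
    rw [dotProduct_mulVec, ← mulVec_transpose, hres, zero_dotProduct]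
  have hsplit : y - A *ᵥ c = (y - A *ᵥ b) - A *ᵥ (c - b) := by
    rw [mulVec_sub, sub_sub_sub_cancel_right]
  rw [hsplit, sub_dotProduct, dotProduct_sub _ (y - A *ᵥ b), dotProduct_sub (A *ᵥ _),
    dotProduct_comm (A *ᵥ _) (y - _), horth]
  ring

lemma forall_dotProduct_residual_le_iff [LinearOrder R] [IsStrictOrderedRing R]
    (hA : Function.Injective A.mulVec) (hb : (Aᵀ * A) *ᵥ b = Aᵀ *ᵥ y) (c : κ → R) :
    (∀ c', (y - A *ᵥ c) ⬝ᵥ (y - A *ᵥ c) ≤ (y - A *ᵥ c') ⬝ᵥ (y - A *ᵥ c')) ↔ c = b := by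
  constructor
  · intro hc
    have hle := hc b
    rw [dotProduct_residual_eq_add hb c, add_le_iff_nonpos_right] at hle
    have hzero : A *ᵥ (c - b) = 0 :=
      dotProduct_self_eq_zero.mp (hle.antisymm (Finset.sum_nonneg fun i _ => mul_self_nonneg _))
    exact sub_eq_zero.mp (hA (hzero.trans (mulVec_zero A).symm))
  · rintro rfl c'
    rw [dotProduct_residual_eq_add hb c', le_add_iff_nonneg_right]
    exact Finset.sum_nonneg fun i _ => mul_self_nonneg _

end LeastSquares

section GaussianLikelihood

variable {ι : Type*} [Fintype ι] {v : ℝ≥0}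

lemma prod_gaussianPDFReal (m y : ι → ℝ) (v : ℝ≥0) :
    ∏ i, gaussianPDFReal (m i) v (y i) =
      (√(2 * Real.pi * v))⁻¹ ^ Fintype.card ι *
        Real.exp (-((y - m) ⬝ᵥ (y - m)) / (2 * v)) := by
  simp only [gaussianPDFReal, Finset.prod_mul_distrib, Finset.prod_const, Finset.card_univ,
    ← Real.exp_sum, ← Finset.sum_div, Finset.sum_neg_distrib, dotProduct, Pi.sub_apply, sq]

lemma prod_gaussianPDFReal_le_iff (hv : v ≠ 0) (m m' y : ι → ℝ) :
    ∏ i, gaussianPDFReal (m i) v (y i) ≤ ∏ i, gaussianPDFReal (m' i) v (y i) ↔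
      (y - m') ⬝ᵥ (y - m') ≤ (y - m) ⬝ᵥ (y - m) := by
  have : (0 : ℝ) < v := by positivity
  rw [prod_gaussianPDFReal, prod_gaussianPDFReal, mul_le_mul_iff_right₀ (by positivity),
    Real.exp_le_exp, div_le_div_iff_of_pos_right (by positivity), neg_le_neg_iff]

lemma hasDerivAt_log_gaussianPDFReal (hv : v ≠ 0) (m y : ℝ) :
    HasDerivAt (fun m => Real.log (gaussianPDFReal m v y)) ((y - m) / v) m := by
  have : (0 : ℝ) < v := by positivity
  have hlog : (fun m => Real.log (gaussianPDFReal m v y)) =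
      fun m => Real.log (√(2 * Real.pi * v))⁻¹ - (y - m) ^ 2 / (2 * v) := by
    funext m
    rw [gaussianPDFReal, Real.log_mul (by positivity) (Real.exp_ne_zero _), Real.log_exp]
    ring
  rw [hlog]
  refine (((((hasDerivAt_id' m).const_sub y).fun_pow 2).div_const (2 * (v : ℝ))).const_sub
    _).congr_deriv ?_
  push_cast
  field_simp

end GaussianLikelihood

lemma posDef_transpose_mul_self {ι κ : Type*} [Fintype ι] [Fintype κ] {A : Matrix ι κ ℝ}
    (hA : Function.Injective A.mulVec) : (Aᵀ * A).PosDef :=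
  PosDef.conjTranspose_mul_self A hA

section MatrixSquareRoot

open scoped ComplexOrder

variable {𝕜 κ : Type*} [RCLike 𝕜] [Fintype κ] [DecidableEq κ] {S : Matrix κ κ 𝕜}

lemma sqrt_mul_inv_mul_sqrt (hS : S.PosDef) : CFC.sqrt S * S⁻¹ * CFC.sqrt S = 1 := by
  have hsq : CFC.sqrt S * CFC.sqrt S = S :=
    CFC.sqrt_mul_sqrt_self S (nonneg_iff_posSemidef.mpr hS.posSemidef)
  have hunit : IsUnit (CFC.sqrt S).det :=
    (isUnit_iff_isUnit_det _).mp (isUnit_of_mul_isUnit_left (hsq.symm ▸ hS.isUnit))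
  rw [← congrArg Inv.inv hsq, Matrix.mul_inv_rev, ← Matrix.mul_assoc, mul_nonsing_inv _ hunit,
    Matrix.one_mul, nonsing_inv_mul _ hunit]

lemma sqrt_smul (hS : S.PosSemidef) {c : ℝ} (hc : 0 ≤ c) :
    CFC.sqrt (c • S) = √c • CFC.sqrt S := by
  refine CFC.sqrt_unique ?_ (smul_nonneg (Real.sqrt_nonneg c) (CFC.sqrt_nonneg S))
  rw [smul_mul_smul_comm, Real.mul_self_sqrt hc,
    CFC.sqrt_mul_sqrt_self S (nonneg_iff_posSemidef.mpr hS)]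

end MatrixSquareRoot

section GaussianLaws

variable {Ω ι κ : Type*} [Fintype ι] [Fintype κ] [DecidableEq κ] [MeasurableSpace Ω]
  {P : Measure Ω}

lemma hasLaw_toLp_multivariateGaussian [DecidableEq ι] {Y : ι → Ω → ℝ} {m : ι → ℝ} {v : ι → ℝ≥0}
    (hY_indep : iIndepFun Y P) (hY_law : ∀ i, HasLaw (Y i) (gaussianReal (m i) (v i)) P) :
    HasLaw (fun ω => toLp 2 fun i => Y i ω)
      (multivariateGaussian (toLp 2 m) (diagonal fun i => (v i : ℝ))) P := by
  have := hY_indep.isProbabilityMeasure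
  have hmeas : AEMeasurable (fun ω => toLp 2 fun i => Y i ω) P := by
    refine (WithLp.measurable_toLp 2 _).comp_aemeasurable ?_
    exact aemeasurable_pi_lambda _ fun i => (hY_law i).aemeasurable
  have hdiag : (diagonal fun i => (v i : ℝ)).PosSemidef :=
    posSemidef_diagonal_iff.mpr fun i => (v i).2
  refine ⟨hmeas, ?_⟩
  have := Measure.isProbabilityMeasure_map (μ := P) hmeas
  refine Measure.ext_of_charFun (funext fun t => ?_)
  rw [(iIndepFun_iff_charFun_pi fun i => (hY_law i).aemeasurable).mp hY_indep t,
    charFun_multivariateGaussian hdiag]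
  simp only [(hY_law _).map_eq, charFun_gaussianReal]
  rw [← Complex.exp_sum, Finset.sum_sub_distrib, ← Finset.sum_mul, ← Finset.sum_div]
  simp [PiLp.inner_apply, dotProduct, mulVec_diagonal, sq, mul_comm, mul_left_comm]

lemma charFun_map_toEuclideanLin [DecidableEq ι] (μ : Measure (EuclideanSpace ℝ ι))
    (B : Matrix κ ι ℝ) (t : EuclideanSpace ℝ κ) :
    charFun (μ.map (toEuclideanLin B)) t = charFun μ (toEuclideanLin Bᵀ t) := by
  have hcont : Continuous (toEuclideanLin B) := LinearMap.continuous_of_finiteDimensional _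
  have hadj (w : EuclideanSpace ℝ ι) :
      inner ℝ (toEuclideanLin B w) t = inner ℝ w (toEuclideanLin Bᵀ t) := by
    rw [← conjTranspose_eq_transpose_of_trivial, toEuclideanLin_conjTranspose_eq_adjoint,
      LinearMap.adjoint_inner_right]
  rw [charFun_apply, charFun_apply, integral_map hcont.aemeasurable (by fun_prop)]
  simp only [hadj]

lemma multivariateGaussian_map_toEuclideanLin_add_const [DecidableEq ι]
    (m : EuclideanSpace ℝ ι) {S : Matrix ι ι ℝ} (hS : S.PosSemidef) (B : Matrix κ ι ℝ)
    (c : EuclideanSpace ℝ κ) :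
    ((multivariateGaussian m S).map (toEuclideanLin B)).map (· + c) =
      multivariateGaussian (toEuclideanLin B m + c) (B * S * Bᵀ) := by
  have hcont : Continuous (toEuclideanLin B) := LinearMap.continuous_of_finiteDimensional _
  have hBSB : (B * S * Bᵀ).PosSemidef := by
    simpa using hS.mul_mul_conjTranspose_same B
  have := Measure.isProbabilityMeasure_map (μ := multivariateGaussian m S) hcont.aemeasurable
  have := Measure.isProbabilityMeasure_map
    (μ := (multivariateGaussian m S).map (toEuclideanLin B)) (measurable_add_const c).aemeasurable
  refine Measure.ext_of_charFun (funext fun t => ?_)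
  rw [charFun_map_add_const, charFun_map_toEuclideanLin, charFun_multivariateGaussian hS,
    charFun_multivariateGaussian hBSB, ← Complex.exp_add]
  have hmean : inner ℝ (toEuclideanLin Bᵀ t) m = inner ℝ t (toEuclideanLin B m) := by
    rw [← conjTranspose_eq_transpose_of_trivial, toEuclideanLin_conjTranspose_eq_adjoint,
      LinearMap.adjoint_inner_left]
  have hcov : ofLp t ⬝ᵥ (B * S * Bᵀ) *ᵥ ofLp t =
      ofLp (toEuclideanLin Bᵀ t) ⬝ᵥ S *ᵥ ofLp (toEuclideanLin Bᵀ t) := by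
    rw [toLpLin_apply, ← mulVec_mulVec, ← mulVec_mulVec, dotProduct_mulVec, mulVec_transpose]
  rw [hmean, hcov, real_inner_comm t c, inner_add_right]
  push_cast
  ring_nf

lemma hasLaw_toEuclideanLin_add_const [DecidableEq ι] {W : Ω → EuclideanSpace ℝ ι}
    {m : EuclideanSpace ℝ ι} {S : Matrix ι ι ℝ} (hW : HasLaw W (multivariateGaussian m S) P)
    (hS : S.PosSemidef) (B : Matrix κ ι ℝ) (c : EuclideanSpace ℝ κ) :
    HasLaw (fun ω => toEuclideanLin B (W ω) + c)
      (multivariateGaussian (toEuclideanLin B m + c) (B * S * Bᵀ)) P := by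
  have hcont : Continuous (toEuclideanLin B) := LinearMap.continuous_of_finiteDimensional _
  have hlaw : HasLaw (fun w => toEuclideanLin B w + c)
      (multivariateGaussian (toEuclideanLin B m + c) (B * S * Bᵀ)) (multivariateGaussian m S) :=
    ⟨(hcont.add_const c).aemeasurable, by
      rw [← multivariateGaussian_map_toEuclideanLin_add_const m hS B c,
        Measure.map_map (measurable_add_const c) hcont.measurable, Function.comp_def]⟩
  exact hlaw.comp hW

lemma hasLaw_of_normal_equations {Y : ι → Ω → ℝ} {A : Matrix ι κ ℝ}
    {β : EuclideanSpace ℝ κ} {v : ℝ≥0} (hA : Function.Injective A.mulVec) (hY_indep : iIndepFun Y P)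
    (hY_law : ∀ i, HasLaw (Y i) (gaussianReal ((A *ᵥ ofLp β) i) v) P)
    {b : Ω → EuclideanSpace ℝ κ}
    (hb : ∀ᵐ ω ∂P, (Aᵀ * A) *ᵥ ofLp (b ω) = Aᵀ *ᵥ fun i => Y i ω) :
    HasLaw b (multivariateGaussian β ((v : ℝ) • (Aᵀ * A)⁻¹)) P := by
  classical
  have hunit : IsUnit (Aᵀ * A).det := (posDef_transpose_mul_self hA).det_pos.ne'.isUnit
  set B : Matrix κ ι ℝ := (Aᵀ * A)⁻¹ * Aᵀ with hB
  have hBA : B * A = 1 := by rw [hB, Matrix.mul_assoc, nonsing_inv_mul _ hunit]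
  have hBBt : B * Bᵀ = (Aᵀ * A)⁻¹ := by
    rw [hB, transpose_mul, transpose_nonsing_inv, transpose_mul, transpose_transpose,
      ← Matrix.mul_assoc, ← hB, hBA, Matrix.one_mul]
  have hsolve : b =ᵐ[P] fun ω => toEuclideanLin B (toLp 2 fun i => Y i ω) + 0 := by
    filter_upwards [hb] with ω hω
    rw [add_zero, toLpLin_apply, hB, ← mulVec_mulVec, ← hω, mulVec_mulVec,
      nonsing_inv_mul _ hunit, one_mulVec, toLp_ofLp]
  have hlaw := hasLaw_toEuclideanLin_add_const (hasLaw_toLp_multivariateGaussian hY_indep hY_law)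
    (posSemidef_diagonal_iff.mpr fun _ => v.2) B 0
  have hmean : toEuclideanLin B (toLp 2 (A *ᵥ ofLp β)) + 0 = β := by
    rw [add_zero, toLpLin_apply, mulVec_mulVec, hBA, one_mulVec, toLp_ofLp]
  have hcov : B * (diagonal fun _ => (v : ℝ) : Matrix ι ι ℝ) * Bᵀ = (v : ℝ) • (Aᵀ * A)⁻¹ := by
    rw [← smul_one_eq_diagonal, Matrix.mul_smul, Matrix.mul_one, Matrix.smul_mul, hBBt]
  rw [hmean, hcov] at hlaw
  exact hlaw.congr hsolve

lemma hasLaw_sqrt_sub {S : Matrix κ κ ℝ} (hS : S.PosDef) {β : EuclideanSpace ℝ κ}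
    {b : Ω → EuclideanSpace ℝ κ} (hb : HasLaw b (multivariateGaussian β S⁻¹) P) :
    HasLaw (fun ω => toEuclideanLin (CFC.sqrt S) (b ω - β)) (multivariateGaussian 0 1) P := by
  have hsymm : (CFC.sqrt S)ᵀ = CFC.sqrt S := by
    simpa [IsHermitian] using (nonneg_iff_posSemidef.mp (CFC.sqrt_nonneg S)).isHermitian
  have hlaw := hasLaw_toEuclideanLin_add_const hb hS.inv.posSemidef (CFC.sqrt S)
    (-toEuclideanLin (CFC.sqrt S) β)
  rw [hsymm, sqrt_mul_inv_mul_sqrt hS, add_neg_cancel] at hlaw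
  simpa only [map_sub, ← sub_eq_add_neg] using hlaw

lemma hasLaw_sqrt_smul_gram_of_normal_equations {Y : ι → Ω → ℝ} {A : Matrix ι κ ℝ}
    {β : EuclideanSpace ℝ κ} {v : ℝ≥0} (hv : v ≠ 0)
    (hA : Function.Injective A.mulVec) (hY_indep : iIndepFun Y P)
    (hY_law : ∀ i, HasLaw (Y i) (gaussianReal ((A *ᵥ ofLp β) i) v) P)
    {b : Ω → EuclideanSpace ℝ κ}
    (hb : ∀ᵐ ω ∂P, (Aᵀ * A) *ᵥ ofLp (b ω) = Aᵀ *ᵥ fun i => Y i ω) :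
    HasLaw (fun ω => toEuclideanLin (CFC.sqrt ((v : ℝ)⁻¹ • (Aᵀ * A))) (b ω - β))
      (multivariateGaussian 0 1) P := by
  have hv' : (0 : ℝ) < v := by positivity
  have hgram := posDef_transpose_mul_self hA
  have hcov : (v : ℝ) • (Aᵀ * A)⁻¹ = ((v : ℝ)⁻¹ • (Aᵀ * A))⁻¹ := by
    refine (inv_eq_right_inv ?_).symm
    rw [smul_mul_smul_comm, inv_mul_cancel₀ hv'.ne', one_smul,
      mul_nonsing_inv _ hgram.det_pos.ne'.isUnit]
  exact hasLaw_sqrt_sub (hgram.smul (inv_pos.mpr hv'))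
    (hcov ▸ hasLaw_of_normal_equations hA hY_indep hY_law hb)

end GaussianLaws

section StraightLine

variable {n : ℕ} {x : Fin n → ℝ} {σ : ℝ}

/-- The design matrix of the straight-line model, with rows `(1, x_i - x̄)`: the vector of
regression values is `designMatrix x *ᵥ β`. -/
noncomputable def designMatrix (x : Fin n → ℝ) : Matrix (Fin n) (Fin 2) ℝ :=
  of fun i => ![1, x i - mean x]

lemma line_eq_designMatrix_mulVec (x : Fin n → ℝ) (β : EuclideanSpace ℝ (Fin 2)) :
    line x β = designMatrix x *ᵥ ofLp β := by
  ext i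
  simp [line, designMatrix, mulVec, dotProduct, Fin.sum_univ_two, mul_comm]

lemma sum_sub_mean (x : Fin n → ℝ) : ∑ i, (x i - mean x) = 0 := by
  rcases n.eq_zero_or_pos with rfl | hn
  · simp
  · simp [mean, mul_div_cancel₀, hn.ne']

lemma transpose_designMatrix_mul_self (x : Fin n → ℝ) :
    (designMatrix x)ᵀ * designMatrix x = diagonal ![(n : ℝ), ∑ i, (x i - mean x) ^ 2] := by
  have hcross := sum_sub_mean x
  ext k l
  fin_cases k <;> fin_cases l <;> simp_all [designMatrix, mul_apply, sq]

lemma designMatrix_mulVec_injective (hx : ∃ i j, x i ≠ x j) :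
    Function.Injective (designMatrix x).mulVec := by
  obtain ⟨i, j, hij⟩ := hx
  intro b c hbc
  have hrow (k : Fin n) : b 0 + (x k - mean x) * b 1 = c 0 + (x k - mean x) * c 1 := by
    simpa [designMatrix, mulVec, dotProduct, Fin.sum_univ_two] using congrFun hbc k
  have hslope : b 1 = c 1 :=
    mul_left_cancel₀ (sub_ne_zero.mpr hij) (by linear_combination hrow i - hrow j)
  have hintercept : b 0 = c 0 := by
    simpa [hslope] using hrow i
  ext k
  fin_cases k
  exacts [hintercept, hslope]

/-- The least squares estimate of the intercept and the slope, in closed form: both are quotients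
because the columns of `designMatrix x` are orthogonal. -/
noncomputable def leastSquares (x y : Fin n → ℝ) : EuclideanSpace ℝ (Fin 2) :=
  !₂[(∑ i, y i) / n, (∑ i, (x i - mean x) * y i) / ∑ i, (x i - mean x) ^ 2]

lemma leastSquares_normal_equations (hx : ∃ i j, x i ≠ x j) (y : Fin n → ℝ) :
    ((designMatrix x)ᵀ * designMatrix x) *ᵥ ofLp (leastSquares x y) = (designMatrix x)ᵀ *ᵥ y := by
  have hgram := posDef_transpose_mul_self (designMatrix_mulVec_injective hx)
  rw [transpose_designMatrix_mul_self, posDef_diagonal_iff] at hgram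
  have hn : (n : ℝ) ≠ 0 := (hgram 0).ne'
  have hS : ∑ i, (x i - mean x) ^ 2 ≠ 0 := (hgram 1).ne'
  rw [transpose_designMatrix_mul_self]
  ext k
  fin_cases k
  · simp [leastSquares, designMatrix, mulVec, dotProduct, mul_div_cancel₀, hn]
  · simp [leastSquares, designMatrix, mulVec, dotProduct, mul_div_cancel₀, hS]

lemma toNNReal_sq_ne_zero (hσ : σ ≠ 0) : (σ ^ 2).toNNReal ≠ 0 :=
  (Real.toNNReal_pos.mpr (by positivity)).ne'

lemma coe_toNNReal_sq (σ : ℝ) : ((σ ^ 2).toNNReal : ℝ) = σ ^ 2 :=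
  Real.coe_toNNReal _ (sq_nonneg σ)

lemma isMLE_iff_forall_dotProduct_residual_le (hσ : σ ≠ 0) (y : Fin n → ℝ)
    (b : EuclideanSpace ℝ (Fin 2)) :
    IsMLE x σ y b ↔ ∀ c : Fin 2 → ℝ,
      (y - designMatrix x *ᵥ ofLp b) ⬝ᵥ (y - designMatrix x *ᵥ ofLp b) ≤
        (y - designMatrix x *ᵥ c) ⬝ᵥ (y - designMatrix x *ᵥ c) := by
  rw [← (WithLp.equiv 2 (Fin 2 → ℝ)).forall_congr_right]
  refine forall_congr' fun β => ?_
  simp only [likelihood, density]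
  rw [prod_gaussianPDFReal_le_iff (toNNReal_sq_ne_zero hσ), line_eq_designMatrix_mulVec,
    line_eq_designMatrix_mulVec, WithLp.equiv_apply]

lemma isMLE_iff_eq_leastSquares (hx : ∃ i j, x i ≠ x j) (hσ : σ ≠ 0) (y : Fin n → ℝ)
    (b : EuclideanSpace ℝ (Fin 2)) : IsMLE x σ y b ↔ b = leastSquares x y := by
  rw [isMLE_iff_forall_dotProduct_residual_le hσ, forall_dotProduct_residual_le_iff
    (designMatrix_mulVec_injective hx) (leastSquares_normal_equations hx y)]
  exact (WithLp.ofLp_injective 2).eq_iff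

lemma partialDeriv_comp_line {f : ℝ → ℝ} {f' : ℝ} {i : Fin n} {β : EuclideanSpace ℝ (Fin 2)}
    (hf : HasDerivAt f f' (line x β i)) (k : Fin 2) :
    partialDeriv k (fun b => f (line x b i)) β = f' * designMatrix x i k := by
  have hline (t : ℝ) : line x (β + t • EuclideanSpace.single k 1) i =
      line x β i + t * designMatrix x i k := by
    simp [line_eq_designMatrix_mulVec, mulVec_add, mulVec_smul]
  have hinner : HasDerivAt (fun t => line x β i + t * designMatrix x i k)
      (designMatrix x i k) 0 := by
    simpa using ((hasDerivAt_id' (0 : ℝ)).mul_const (designMatrix x i k)).const_add (line x β i)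
  simp only [partialDeriv, lineDeriv, hline]
  exact (HasDerivAt.comp 0 (by simpa using hf) hinner).deriv

lemma logDensityHessian_apply (hσ : σ ≠ 0) (i : Fin n) (y : ℝ) (β : EuclideanSpace ℝ (Fin 2))
    (k l : Fin 2) :
    logDensityHessian x σ i y β k l =
      -((σ ^ 2)⁻¹ * (designMatrix x i k * designMatrix x i l)) := by
  have hscore (b : EuclideanSpace ℝ (Fin 2)) :
      partialDeriv l (fun b => Real.log (density x σ i b y)) b =
        (y - line x b i) / σ ^ 2 * designMatrix x i l := by
    rw [← coe_toNNReal_sq σ]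
    exact partialDeriv_comp_line (hasDerivAt_log_gaussianPDFReal (toNNReal_sq_ne_zero hσ) _ y) l
  have hscore_deriv : HasDerivAt (fun m => (y - m) / σ ^ 2 * designMatrix x i l)
      (-1 / σ ^ 2 * designMatrix x i l) (line x β i) :=
    (((hasDerivAt_id' _).const_sub y).div_const _).mul_const _
  rw [logDensityHessian, of_apply, funext hscore, partialDeriv_comp_line hscore_deriv]
  ring

lemma sum_fisherInfo (hσ : σ ≠ 0) (x : Fin n → ℝ) (β : EuclideanSpace ℝ (Fin 2)) :
    ∑ i, fisherInfo x σ i β = (σ ^ 2)⁻¹ • ((designMatrix x)ᵀ * designMatrix x) := by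
  ext k l
  simp [Matrix.sum_apply, fisherInfo, logDensityHessian_apply hσ, responseLaw, mul_apply,
    Finset.mul_sum]

lemma normalized_eq (hn : n ≠ 0) (hσ : σ ≠ 0) (x : Fin n → ℝ) (β₀ b : EuclideanSpace ℝ (Fin 2)) :
    normalized x σ β₀ b =
      toEuclideanLin (CFC.sqrt ((σ ^ 2)⁻¹ • ((designMatrix x)ᵀ * designMatrix x))) (b - β₀) := by
  have hpsd : ((σ ^ 2)⁻¹ • ((designMatrix x)ᵀ * designMatrix x)).PosSemidef := by
    have hgram := posSemidef_conjTranspose_mul_self (designMatrix x)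
    rw [conjTranspose_eq_transpose_of_trivial] at hgram
    exact hgram.smul (by positivity)
  have hscale : √(n : ℝ) * √(n : ℝ)⁻¹ = 1 := by
    rw [← Real.sqrt_mul n.cast_nonneg, mul_inv_cancel₀ (Nat.cast_ne_zero.mpr hn), Real.sqrt_one]
  rw [normalized, avgFisherInfo, sum_fisherInfo hσ, sqrt_smul hpsd (by positivity), map_smul,
    LinearMap.smul_apply, smul_smul, hscale, one_smul]

lemma hasLaw_normalized_leastSquares {Ω : Type*} [MeasurableSpace Ω] {P : Measure Ω}
    (hx : ∃ i j, x i ≠ x j) (hσ : σ ≠ 0) {β₀ : EuclideanSpace ℝ (Fin 2)} {Y : Fin n → Ω → ℝ}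
    (hY_indep : iIndepFun Y P) (hY_law : ∀ i, HasLaw (Y i) (responseLaw x σ β₀ i) P) :
    HasLaw (fun ω => normalized x σ β₀ (leastSquares x fun i => Y i ω))
      (multivariateGaussian 0 1) P := by
  have hn : n ≠ 0 := by
    rintro rfl
    exact hx.choose.elim0
  simp only [responseLaw, line_eq_designMatrix_mulVec] at hY_law
  simpa only [normalized_eq hn hσ, coe_toNNReal_sq] using
    hasLaw_sqrt_smul_gram_of_normal_equations (toNNReal_sq_ne_zero hσ)
      (designMatrix_mulVec_injective hx) hY_indep hY_law
      (ae_of_all _ fun ω => leastSquares_normal_equations hx fun i => Y i ω)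

lemma hasLaw_normalized_of_isMLE {Ω : Type*} [MeasurableSpace Ω] {P : Measure Ω}
    (hx : ∃ i j, x i ≠ x j) (hσ : σ ≠ 0) {β₀ : EuclideanSpace ℝ (Fin 2)} {Y : Fin n → Ω → ℝ}
    (hY_indep : iIndepFun Y P) (hY_law : ∀ i, HasLaw (Y i) (responseLaw x σ β₀ i) P)
    {βhat : Ω → EuclideanSpace ℝ (Fin 2)}
    (hβhat : ∀ᵐ ω ∂P, IsMLE x σ (fun i => Y i ω) (βhat ω)) :
    HasLaw (fun ω => normalized x σ β₀ (βhat ω)) (multivariateGaussian 0 1) P :=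
  (hasLaw_normalized_leastSquares hx hσ hY_indep hY_law).congr <| hβhat.mono fun _ hω =>
    congrArg (normalized x σ β₀) ((isMLE_iff_eq_leastSquares hx hσ _ _).mp hω)

end StraightLine

end SimpleLinear

theorem mainTheorem6_general {Ω Ω' : Type*} [MeasurableSpace Ω] [MeasurableSpace Ω']
    {P : Measure Ω} {Q : Measure Ω'} {n : ℕ} {x : Fin n → ℝ} (hx : ∃ i j, x i ≠ x j)
    {σ : ℝ} (hσ : σ ≠ 0) {β₀ : EuclideanSpace ℝ (Fin 2)}
    {Y : Fin n → Ω → ℝ} (hY_indep : iIndepFun Y P)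
    (hY_law : ∀ i, HasLaw (Y i) (responseLaw x σ β₀ i) P)
    {Z : Ω' → EuclideanSpace ℝ (Fin 2)} (hZ : HasLaw Z (multivariateGaussian 0 1) Q)
    {h : EuclideanSpace ℝ (Fin 2) → ℝ} {K : ℝ≥0} (hh : LipschitzWith K h) :
    (∀ (y : Fin n → ℝ) (b : EuclideanSpace ℝ (Fin 2)), IsMLE x σ y b ↔
      b = !₂[(∑ i, y i) / n, (∑ i, (x i - mean x) * y i) / ∑ i, (x i - mean x) ^ 2]) ∧
    ∀ βhat : Ω → EuclideanSpace ℝ (Fin 2), (∀ᵐ ω ∂P, IsMLE x σ (fun i => Y i ω) (βhat ω)) →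
      Integrable (fun ω => h (normalized x σ β₀ (βhat ω))) P ∧
      Integrable (fun ω => h (Z ω)) Q ∧
      ∫ ω, h (normalized x σ β₀ (βhat ω)) ∂P = ∫ ω, h (Z ω) ∂Q := by
  refine ⟨isMLE_iff_eq_leastSquares hx hσ, fun βhat hβhat => ?_⟩
  have hlaw := hasLaw_normalized_of_isMLE hx hσ hY_indep hY_law hβhat
  have := hlaw.isProbabilityMeasure
  have := hZ.isProbabilityMeasure
  exact ⟨integrable_comp_of_lipschitzWith hh hlaw.hasGaussianLaw.integrable,
    integrable_comp_of_lipschitzWith hh hZ.hasGaussianLaw.integrable,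
    ((hlaw.identDistrib hZ).comp hh.continuous.measurable).integral_eq⟩

theorem mainTheorem6 {Ω Ω' : Type*} [MeasurableSpace Ω] [MeasurableSpace Ω']
    (P : Measure Ω) [IsProbabilityMeasure P] (Q : Measure Ω') [IsProbabilityMeasure Q]
    (n : ℕ) (x : Fin n → ℝ) (hx : ∃ i j, x i ≠ x j)
    (σ : ℝ) (hσ : 0 < σ) (β₀ : EuclideanSpace ℝ (Fin 2))
    (Y : Fin n → Ω → ℝ) (hY_indep : iIndepFun Y P)
    (hY_law : ∀ i, HasLaw (Y i) (responseLaw x σ β₀ i) P)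
    (Z : Ω' → EuclideanSpace ℝ (Fin 2)) (hZ : HasLaw Z (multivariateGaussian 0 1) Q)
    (h : EuclideanSpace ℝ (Fin 2) → ℝ) (hh : IsTestFunction h) :
    (∀ (y : Fin n → ℝ) (b : EuclideanSpace ℝ (Fin 2)), IsMLE x σ y b ↔
      b = !₂[(∑ i, y i) / n, (∑ i, (x i - mean x) * y i) / ∑ i, (x i - mean x) ^ 2]) ∧
    ∀ βhat : Ω → EuclideanSpace ℝ (Fin 2), (∀ ω, IsMLE x σ (fun i => Y i ω) (βhat ω)) →
      Integrable (fun ω => h (normalized x σ β₀ (βhat ω))) P ∧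
      Integrable (fun ω => h (Z ω)) Q ∧
      |(∫ ω, h (normalized x σ β₀ (βhat ω)) ∂P) - ∫ ω, h (Z ω) ∂Q| ≤
        derivNorm₂ h / 4 *
            (√(2 / n) + √(2 * ∑ i, (x i - mean x) ^ 4) / ∑ i, (x i - mean x) ^ 2)
          + derivNorm₂ h / √(2 * n)
          + 8 * derivNorm₃ h / (3 * √Real.pi) *
            (1 / √n + (∑ i, |x i - mean x| ^ 3) / (∑ i, (x i - mean x) ^ 2) ^ (3 / 2 : ℝ)) := by
  obtain ⟨K, hK⟩ := hh.exists_lipschitzWith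
  obtain ⟨hmle, hexp⟩ := mainTheorem6_general hx hσ.ne' hY_indep hY_law hZ hK
  refine ⟨hmle, fun βhat hβhat => (hexp βhat (ae_of_all _ hβhat)).imp_right <|
    And.imp_right fun heq => ?_⟩
  have hnorm₂ := derivNorm₂_nonneg h
  have hnorm₃ := derivNorm₃_nonneg h
  rw [heq, sub_self, abs_zero]
  positivity
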